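/- **Theorem 6.4.** Let $\mathbb B=\{0,1\}$, and let $\mathcal A=(Q,q_0,\delta,c)$ be a deterministic parity automaton over the alphabet $\mathbb B^2$: $Q$ is a finite set of states, $q_0\in Q$, $\delta:Q\times\mathbb B^2\to Q$ and $c:Q\to\mathbb N$. Let $L(\mathcal A)\subseteq(\mathbb B^2)^\omega$ be the set of infinite words on whose run from $q_0$ the maximal colour $c(q)$ seen infinitely often is even. Let $n=|Q|$, let $m=|c(Q)|$ be the number of colours, and let $n'=2^{(mn)^{2n}}$. For $f:\mathbb N\to\mathbb N_{>0}$, consider the following game: in round $i=0,1,2,\dots$ Player I chooses $f(i)$ bits, and then Player O chooses one bit. In this way Player I builds up an infinite sequence $\alpha=a_0a_1\cdots$ and Player O builds up $\beta=b_0b_1\cdots$; Player O wins the play if the word $(a_0,b_0)(a_1,b_1)(a_2,b_2)\cdots$ is in $L(\mathcal A)$. Say that $L(\mathcal A)$ is *solvable with finite delay* if Player O has a winning strategy in this game for some $f$, and *solvable with constant delay $d$* if she has one for $f(0)=d+1$ and $f(i)=1$ for all $i>0$. An operator $\lambda:\mathbb B^\omega\to\mathbb B^\omega$ is *continuous* if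 it is so for the product (Cantor) topology, and it is a *$d$-delay operator* if, for all $i$, the bit $\lambda(\alpha)_i$ depends only on $\alpha_0\cdots\alpha_{i+d}$. Then: 1. $L(\mathcal A)$ is solvable with finite delay if and only if it is solvable with constant delay $2n'-1$. 2. There is a continuous operator $\lambda$ with $(\alpha,\lambda(\alpha))\in L(\mathcal A)$ for all $\alpha\in\mathbb B^\omega$ if and only if there is a $(2n'-1)$-delay operator with this property. 3. $L(\mathcal A)$ is solvable with finite delay if and only if there is a continuous operator $\lambda$ with $(\alpha,\lambda(\alpha))\in L(\mathcal A)$ for all $\alpha\in\mathbb B^\omega$. (Here $(\alpha,\beta)$ is identified with the infinite word $(\alpha_0,\beta_0)(\alpha_1,\beta_1)\cdots$ over $\mathbb B^2$.) -/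

import Mathlib

namespace DelayGame

/-- Infinite words over `S`. -/
abbrev Word (S : Type*) : Type _ := ℕ → S

/-- Deterministic automata over the alphabet `S` with state set `Q` and a colouring of the states.
The set of states is assumed finite wherever such an automaton is used. -/
structure DPA (S Q : Type*) where
  start : Q
  step : Q → S → Q
  colour : Q → ℕ

namespace DPA

variable {S Q : Type*}

/-- The run of the automaton on an infinite word. -/
def run (A : DPA S Q) (w : Word S) : ℕ → Q
  | 0 => A.start
  | i + 1 => A.step (A.run w i) (w i)

/-- The colours that are seen infinitely often in the run on `w`. -/
def infColours (A : DPA S Q) (w : Word S) : Set ℕ :=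
  {k | ∃ᶠ i in Filter.atTop, A.colour (A.run w i) = k}

/-- The language of the automaton (max-parity acceptance): the maximal colour seen infinitely
often is even. -/
def language (A : DPA S Q) : Set (Word S) :=
  {w | ∃ k, IsGreatest (A.infColours w) k ∧ Even k}

/-- The number of colours of the automaton. -/
def numColours [Fintype Q] (A : DPA S Q) : ℕ :=
  (Finset.univ.image A.colour).card

end DPA

/-- The word over pairs with first component `a` and second component `b`. -/
def pairWord (a b : Word Bool) : Word (Bool × Bool) := fun i => (a i, b i)

/-- The finite word formed by the first `k` letters of `w`. -/
def pre {S : Type*} (w : Word S) (k : ℕ) : List S := List.ofFn fun j : Fin k => w j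

/-- A strategy of Player O: it maps the bits chosen so far by Player I and the bits chosen so far
by Player O herself to her next bit. -/
abbrev StrategyO : Type := List Bool → List Bool → Bool

/-- In round `i` of the game with delay function `f`, Player I chooses `f i` bits, and then
Player O chooses one bit. A play is thus given by the stream `a` of all bits of Player I and the
stream `b` of all bits of Player O. It is consistent with the strategy `s` if, in each round `i`,
the bit `b i` is the answer of `s` to the `f 0 + ⋯ + f i` bits of Player I and the `i` bits
of Player O chosen before. -/
def Consistent (f : ℕ → ℕ+) (s : StrategyO) (a b : Word Bool) : Prop :=
  ∀ i, b i = s (pre a (∑ j ∈ Finset.range (i + 1), (f j : ℕ))) (pre b i)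

/-- Player O wins the game with delay function `f` and winning condition `L`. -/
def PlayerOWins (L : Set (Word (Bool × Bool))) (f : ℕ → ℕ+) : Prop :=
  ∃ s : StrategyO, ∀ a b : Word Bool, Consistent f s a b → pairWord a b ∈ L

/-- The constant delay function: `d + 1` bits in round `0`, and one bit in each later round. -/
def constDelay (d : ℕ) : ℕ → ℕ+ := fun i => if i = 0 then d.succPNat else 1

def SolvableWithFiniteDelay (L : Set (Word (Bool × Bool))) : Prop :=
  ∃ f : ℕ → ℕ+, PlayerOWins L f

def SolvableWithConstantDelay (L : Set (Word (Bool × Bool))) (d : ℕ) : Prop :=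
  PlayerOWins L (constDelay d)

/-- `F` is an `h`-delay operator: bit `i` of the output depends only on the input bits
`0, …, h i`. -/
def IsDelayOperator (h : ℕ → ℕ) (F : Word Bool → Word Bool) : Prop :=
  ∀ i : ℕ, ∀ a a' : Word Bool, (∀ j ≤ h i, a j = a' j) → F a i = F a' i

/-- `F` is a `d`-delay operator. -/
def IsConstantDelayOperator (d : ℕ) (F : Word Bool → Word Bool) : Prop :=
  IsDelayOperator (fun i => i + d) F

/-- For every input stream `a`, the pair of `a` and `F a` belongs to `L`. -/
def Solves (L : Set (Word (Bool × Bool))) (F : Word Bool → Word Bool) : Prop :=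
  ∀ a : Word Bool, pairWord a (F a) ∈ L

/-- The number `2 ^ ((m n) ^ (2 n))`. -/
def delayBound (n m : ℕ) : ℕ := 2 ^ ((m * n) ^ (2 * n))

end DelayGame

/-!
The automaton distinguishes only finitely many kinds of input blocks. The *profile* of a finite
input word `x` is the set of all `(q, q', c)` such that some output word of the length of `x` leads
the automaton from `q` to `q'` with maximal colour `c`. There are at most `2 ^ (n * (n * m))`
profiles, which is at most `delayBound n m`, and the profile is computed by a finite automaton. So,
by pumping, every word of length `N = delayBound n m` has the profile of arbitrarily long words
(`DPA.exists_profile_eq_of_le_length`).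

Let `F` be a continuous operator that solves the winning condition. By compactness, output bit `i`
depends on the input bits up to some `h i` only (`exists_isDelayOperator_of_continuous`). Cut an
input `a` into blocks of length `N`, and replace these one by one by words with the same profiles,
each so long that the answer of `F` to the blocks before it is determined when it is known. The
answer of `F` to the resulting word leads the automaton through states `q 0, q 1, …` at the ends of
the blocks, with block maxima `c 0, c 1, …`. As the profiles are the same, block `i` of `a` itself
also has an answer of length `N` that leads from `q i` to `q (i + 1)` with maximal colour `c i`. The
concatenation of these answers is an output for `a`, and it is accepted because acceptance depends
only on the block maxima (`DPA.mem_language_of_blocks`). Block `i` of the output depends on the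
blocks `0, …, i + 1` of `a`, which is a delay of at most `2 * N - 1` (`DPA.exists_constantDelay`).

The rest is the correspondence between strategies and delay operators
(`PlayerOWins.exists_operator`, `IsDelayOperator.playerOWins`) and the continuity of the latter.
No determinacy result is needed, because only winning strategies of Player O are transferred.
-/

namespace DelayGame

/-! ### Strategies and operators -/

theorem length_pre {S : Type*} (w : Word S) (k : ℕ) : (pre w k).length = k := by
  simp [pre]

theorem pre_succ {S : Type*} (w : Word S) (k : ℕ) : pre w (k + 1) = pre w k ++ [w k] := by
  rw [pre, List.ofFn_succ_last]
  rfl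

theorem pre_congr {S : Type*} {w w' : Word S} {k : ℕ} (h : ∀ j < k, w j = w' j) :
    pre w k = pre w' k := by
  unfold pre
  congr 1
  funext j
  exact h j j.2

theorem pre_getD {w : Word Bool} {k j : ℕ} (h : j < k) : (pre w k).getD j false = w j := by
  simp [pre, h]

/-- The list of the first `i` answers of the strategy `s` against the input `a`, where `g i` bits
of the input are known when bit `i` of the output is due. -/
def responses (g : ℕ → ℕ) (s : StrategyO) (a : Word Bool) : ℕ → List Bool
  | 0 => []
  | i + 1 => responses g s a i ++ [s (pre a (g i)) (responses g s a i)]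

theorem responses_congr {g : ℕ → ℕ} (s : StrategyO) {a a' : Word Bool} (i : ℕ)
    (h : ∀ k < i, ∀ j < g k, a j = a' j) : responses g s a i = responses g s a' i := by
  induction i with
  | zero => rfl
  | succ i ih =>
    rw [responses, responses, ih fun k hk => h k (by omega), pre_congr (h i (by omega))]

theorem monotone_sum_delay (f : ℕ → ℕ+) :
    Monotone fun i => ∑ j ∈ Finset.range (i + 1), (f j : ℕ) := fun i j hij =>
  Finset.sum_le_sum_of_subset (Finset.range_mono (by omega))

/-- A winning strategy answers every input with exactly one output, and this defines a delay
operator. -/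
theorem PlayerOWins.exists_operator {L : Set (Word (Bool × Bool))} {f : ℕ → ℕ+}
    (hw : PlayerOWins L f) :
    ∃ F, IsDelayOperator (fun i => ∑ j ∈ Finset.range (i + 1), (f j : ℕ) - 1) F ∧ Solves L F := by
  obtain ⟨s, hs⟩ := hw
  set g : ℕ → ℕ := fun i => ∑ j ∈ Finset.range (i + 1), (f j : ℕ)
  have hmono : Monotone g := monotone_sum_delay f
  refine ⟨fun a i => s (pre a (g i)) (responses g s a i), ?_, ?_⟩
  · intro i a a' h
    have h' : ∀ j < g i, a j = a' j := fun j hj => h j (Nat.le_sub_one_of_lt hj)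
    have h1 : responses g s a i = responses g s a' i :=
      responses_congr s i fun k hk j hj => h' j (hj.trans_le (hmono hk.le))
    simp only [h1, pre_congr h']
  · intro a
    refine hs a _ fun i => ?_
    have key : ∀ i, pre (fun i => s (pre a (g i)) (responses g s a i)) i = responses g s a i := by
      intro i
      induction i with
      | zero => rfl
      | succ i ih => rw [pre_succ, ih, responses]
    rw [key]

/-- A delay operator is a strategy that ignores the bits of Player O and pads the known bits of
Player I to an infinite word. -/
theorem IsDelayOperator.playerOWins {L : Set (Word (Bool × Bool))} {h : ℕ → ℕ}
    {F : Word Bool → Word Bool} (hF : IsDelayOperator h F) (hs : Solves L F) {f : ℕ → ℕ+}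
    (hf : ∀ i, h i < ∑ j ∈ Finset.range (i + 1), (f j : ℕ)) : PlayerOWins L f := by
  refine ⟨fun u v => F (fun j => u.getD j false) v.length, fun a b hc => ?_⟩
  have hb : b = F a := by
    funext i
    refine (hc i).trans ?_
    simp only [length_pre]
    exact hF i _ _ fun j hj => pre_getD (hj.trans_lt (hf i))
  exact hb ▸ hs a

theorem sum_constDelay (d i : ℕ) :
    ∑ j ∈ Finset.range (i + 1), (constDelay d j : ℕ) = i + d + 1 := by
  rw [Finset.sum_range_succ']
  simp [constDelay]
  ring

theorem solvableWithConstantDelay_iff {L : Set (Word (Bool × Bool))} {d : ℕ} :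
    SolvableWithConstantDelay L d ↔ ∃ F, IsConstantDelayOperator d F ∧ Solves L F := by
  constructor
  · intro h
    simpa [sum_constDelay, IsConstantDelayOperator] using PlayerOWins.exists_operator h
  · rintro ⟨F, hF, hs⟩
    exact IsDelayOperator.playerOWins hF hs fun i => by rw [sum_constDelay]; omega

theorem solvableWithFiniteDelay_iff {L : Set (Word (Bool × Bool))} :
    SolvableWithFiniteDelay L ↔ ∃ h F, IsDelayOperator h F ∧ Solves L F := by
  constructor
  · rintro ⟨f, hf⟩
    exact ⟨_, hf.exists_operator⟩
  · rintro ⟨h, F, hF, hs⟩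
    refine ⟨fun i => (h i).succPNat, hF.playerOWins hs fun i => ?_⟩
    rw [Finset.sum_range_succ, Nat.succPNat_coe]
    omega

/-! ### Continuity -/

theorem IsDelayOperator.continuous {h : ℕ → ℕ} {F : Word Bool → Word Bool}
    (hF : IsDelayOperator h F) : Continuous F := by
  refine continuous_pi fun i => IsLocallyConstant.continuous ?_
  refine (IsLocallyConstant.iff_eventually_eq _).2 fun a => ?_
  have : ∀ᶠ a' in nhds a, a' ∈ PiNat.cylinder a (h i + 1) :=
    (PiNat.isOpen_cylinder (fun _ => Bool) a _).mem_nhds (PiNat.self_mem_cylinder a _)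
  filter_upwards [this] with a' ha'
  exact hF i a' a fun j hj => ha' j (by omega)

/-- By compactness of the Cantor space, each output bit of a continuous operator depends on a
bounded number of input bits. -/
theorem exists_isDelayOperator_of_continuous {F : Word Bool → Word Bool} (hF : Continuous F) :
    ∃ h : ℕ → ℕ, Monotone h ∧ IsDelayOperator h F := by
  have hbit : ∀ i, ∃ N, ∀ a a' : Word Bool, (∀ j < N, a j = a' j) → F a i = F a' i := by
    intro i
    have hloc : ∀ a : Word Bool, ∃ n, ∀ a' ∈ PiNat.cylinder a n, F a' i = F a i := by
      intro a
      have ho : IsOpen {a' : Word Bool | F a' i = F a i} :=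
        (isOpen_discrete {F a i}).preimage ((continuous_apply i).comp hF)
      obtain ⟨_, ⟨x, n, rfl⟩, hx, hsub⟩ :=
        (PiNat.isTopologicalBasis_cylinders fun _ : ℕ => Bool).exists_subset_of_mem_open
          (show a ∈ {a' : Word Bool | F a' i = F a i} from rfl) ho
      rw [PiNat.mem_cylinder_iff_eq.1 hx |>.symm] at hsub
      exact ⟨n, fun a' ha' => hsub ha'⟩
    choose n hn using hloc
    obtain ⟨t, -, ht⟩ := isCompact_univ.elim_nhds_subcover
      (fun a : Word Bool => PiNat.cylinder a (n a)) fun a _ =>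
        (PiNat.isOpen_cylinder (fun _ => Bool) a _).mem_nhds (PiNat.self_mem_cylinder a _)
    refine ⟨t.sup n, fun a a' h => ?_⟩
    obtain ⟨c, hc, hac⟩ := Set.mem_iUnion₂.1 (ht (Set.mem_univ a))
    rw [hn c a hac, hn c a' fun j hj => ?_]
    rw [← h j (hj.trans_le (Finset.le_sup hc))]
    exact hac j hj
  choose N hN using hbit
  refine ⟨fun i => ∑ j ∈ Finset.range (i + 1), N j, fun i j hij =>
    Finset.sum_le_sum_of_subset (Finset.range_mono (by omega)), fun i a a' h => ?_⟩
  refine hN i a a' fun j hj => h j (hj.le.trans ?_)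
  exact Finset.single_le_sum (f := N) (fun _ _ => Nat.zero_le _) (Finset.self_mem_range_succ i)

/-! ### Segments of infinite words -/

/-- The finite word formed by the `l` letters of `w` from position `i` on. -/
def seg {S : Type*} (w : Word S) (i l : ℕ) : List S := (List.range' i l).map w

@[simp]
theorem length_seg {S : Type*} (w : Word S) (i l : ℕ) : (seg w i l).length = l := by
  simp [seg]

theorem seg_succ {S : Type*} (w : Word S) (i l : ℕ) :
    seg w i (l + 1) = seg w i l ++ [w (i + l)] := by
  simp [seg, List.range'_1_concat]

theorem seg_congr {S : Type*} {w w' : Word S} {i l : ℕ}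
    (h : ∀ j < i + l, w j = w' j) : seg w i l = seg w' i l := by
  refine List.map_congr_left fun j hj => h j ?_
  have := List.mem_range'_1.1 hj
  omega

theorem seg_pairWord (a b : Word Bool) (i l : ℕ) :
    seg (pairWord a b) i l = (seg a i l).zip (seg b i l) := by
  rw [seg, seg, seg, List.zip_map']
  rfl

namespace DPA

/-! ### Maximal colours along a run -/

section

variable {S Q : Type*} (A : DPA S Q)

/-- The colours occurring in the automaton, as a type; it is finite if the state set is. -/
abbrev Colour : Type := Set.range A.colour

/-- The colour of a state, as an element of `A.Colour`. -/
def colourOf (q : Q) : A.Colour := ⟨A.colour q, q, rfl⟩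

/-- One step of the automaton that also records the maximal colour seen. -/
def stepMax (p : Q × A.Colour) (s : S) : Q × A.Colour :=
  (A.step p.1 s, max p.2 (A.colourOf (A.step p.1 s)))

/-- The last state of the run from `q` on a finite word, together with the maximal colour of this
run. The colours of both ends of the run are counted. -/
def runMax (q : Q) (x : List S) : Q × A.Colour := x.foldl A.stepMax (q, A.colourOf q)

theorem runMax_append_singleton (q : Q) (x : List S) (s : S) :
    A.runMax q (x ++ [s]) = A.stepMax (A.runMax q x) s := by
  simp [runMax]

theorem runMax_seg_fst (w : Word S) (i l : ℕ) :
    (A.runMax (A.run w i) (seg w i l)).1 = A.run w (i + l) := by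
  induction l with
  | zero => rfl
  | succ l ih => rw [seg_succ, runMax_append_singleton, stepMax, ih]; rfl

theorem le_runMax_seg_snd (w : Word S) (i l t : ℕ) :
    t ≤ (A.runMax (A.run w i) (seg w i l)).2 ↔
      ∃ j, i ≤ j ∧ j ≤ i + l ∧ t ≤ A.colour (A.run w j) := by
  induction l with
  | zero =>
    constructor
    · exact fun h => ⟨i, le_rfl, le_rfl, h⟩
    · rintro ⟨j, h1, h2, h⟩
      obtain rfl : j = i := by omega
      exact h
  | succ l ih =>
    rw [seg_succ, runMax_append_singleton, stepMax, runMax_seg_fst]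
    have hmax : ∀ c d : A.Colour, t ≤ ((max c d : A.Colour) : ℕ) ↔ t ≤ (c : ℕ) ∨ t ≤ (d : ℕ) := by
      intro c d
      rcases le_total c d with h | h
      · rw [max_eq_right h]
        exact ⟨Or.inr, fun h' => h'.elim (fun h' => h'.trans h) id⟩
      · rw [max_eq_left h]
        exact ⟨Or.inl, fun h' => h'.elim id (fun h' => h'.trans h)⟩
    rw [hmax, ih]
    constructor
    · rintro (⟨j, h1, h2, h⟩ | h)
      · exact ⟨j, h1, by omega, h⟩
      · exact ⟨i + l + 1, by omega, by omega, h⟩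
    · rintro ⟨j, h1, h2, h⟩
      rcases Nat.lt_or_ge j (i + l + 1) with hj | hj
      · exact Or.inl ⟨j, h1, by omega, h⟩
      · obtain rfl : j = i + l + 1 := by omega
        exact Or.inr h

/-! ### Acceptance read off from blocks -/

/-- For finitely many colours, the greatest colour seen infinitely often is determined by the
thresholds that are reached infinitely often. -/
theorem isGreatest_infColours_iff [Finite Q] (w : Word S) (k : ℕ) :
    IsGreatest (A.infColours w) k ↔
      (∃ᶠ i in Filter.atTop, k ≤ A.colour (A.run w i)) ∧
        ¬ ∃ᶠ i in Filter.atTop, k + 1 ≤ A.colour (A.run w i) := by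
  constructor
  · rintro ⟨hk, hub⟩
    refine ⟨hk.mono fun i hi => hi.ge, fun hfr => ?_⟩
    -- Finitely many states are above the threshold, so one of them is visited infinitely often.
    have hex : ∃ᶠ i in Filter.atTop, ∃ q : Q, k + 1 ≤ A.colour q ∧ A.run w i = q :=
      hfr.mono fun i hi => ⟨_, hi, rfl⟩
    have : ∃ q : Q, ∃ᶠ i in Filter.atTop, k + 1 ≤ A.colour q ∧ A.run w i = q := by
      by_contra hno
      push Not at hno
      obtain ⟨i, ⟨q, h1, h2⟩, hi⟩ := (hex.and_eventually (Filter.eventually_all.2 hno)).exists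
      exact hi q h1 h2
    obtain ⟨q, hq⟩ := this
    obtain ⟨_, hle, -⟩ := hq.exists
    have := hub (show A.colour q ∈ A.infColours w from hq.mono fun i hi => by rw [hi.2])
    omega
  · rintro ⟨hk, hn⟩
    rw [Filter.not_frequently] at hn
    refine ⟨(hk.and_eventually hn).mono fun i hi => by omega, fun c hc => ?_⟩
    obtain ⟨i, h1, h2⟩ := (Filter.Frequently.and_eventually hc hn).exists
    omega

theorem frequently_le_colour_iff (w : Word S) {p : ℕ → ℕ} (hp : StrictMono p) (h0 : p 0 = 0)
    (t : ℕ) :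
    (∃ᶠ j in Filter.atTop, t ≤ A.colour (A.run w j)) ↔
      ∃ᶠ i in Filter.atTop,
        t ≤ (A.runMax (A.run w (p i)) (seg w (p i) (p (i + 1) - p i))).2 := by
  simp only [Filter.frequently_atTop, le_runMax_seg_snd]
  constructor
  · intro h i₀
    obtain ⟨j, hj, ht⟩ := h (p i₀)
    obtain ⟨i, hi⟩ : ∃ i, p i ≤ j ∧ j < p (i + 1) := by
      have hP : ∃ i, j < p i := ⟨j + 1, hp.le_apply⟩
      classical
      have hpos : Nat.find hP ≠ 0 := fun h => by
        have := Nat.find_spec hP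
        rw [h, h0] at this
        omega
      refine ⟨Nat.find hP - 1, ?_, ?_⟩
      · exact not_lt.1 (Nat.find_min hP (by omega))
      · rw [Nat.sub_add_cancel (by omega)]
        exact Nat.find_spec hP
    refine ⟨i, ?_, j, hi.1, by omega, ht⟩
    have : i₀ < i + 1 := hp.lt_iff_lt.1 (hj.trans_lt hi.2)
    omega
  · intro h j₀
    obtain ⟨i, hi, j, h1, -, ht⟩ := h j₀
    exact ⟨j, hi.trans (hp.le_apply.trans h1), ht⟩

/-- Acceptance depends only on the maximal colours of the blocks of a run. The two words may be
cut into blocks of different lengths. -/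
theorem mem_language_of_blocks [Finite Q] {w w' : Word S} {p p' : ℕ → ℕ}
    (hp : StrictMono p) (h0 : p 0 = 0) (hp' : StrictMono p') (h0' : p' 0 = 0)
    (h : ∀ i, (A.runMax (A.run w (p i)) (seg w (p i) (p (i + 1) - p i))).2 =
      (A.runMax (A.run w' (p' i)) (seg w' (p' i) (p' (i + 1) - p' i))).2)
    (hw : w ∈ A.language) : w' ∈ A.language := by
  obtain ⟨k, hk, he⟩ := hw
  refine ⟨k, ?_, he⟩
  rw [isGreatest_infColours_iff] at hk ⊢
  simpa only [A.frequently_le_colour_iff w hp h0, A.frequently_le_colour_iff w' hp' h0', h] using hk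

end

/-! ### Profiles of input words -/

variable {Q : Type*} (A : DPA (Bool × Bool) Q)

/-- The nondeterministic automaton that reads input bits and guesses output bits. Its state
`(q, p)` means that the guessed run started in `q` and that `p` consists of its last state and its
maximal colour. Every `q` is a possible start; acceptance plays no role. -/
def guess : NFA Bool (Q × Q × A.Colour) where
  step t a := {t' | ∃ b, t' = (t.1, A.stepMax t.2 (a, b))}
  start := {t | t.2 = (t.1, A.colourOf t.1)}
  accept := ∅

/-- The profile of a finite input word `x`: the set of all `(q, p)` such that some output word of
the length of `x` leads from `q` to the state `p.1` with maximal colour `p.2`. -/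
def profile (x : List Bool) : Set (Q × Q × A.Colour) := A.guess.eval x

theorem mem_profile {x : List Bool} {q : Q} {p : Q × A.Colour} :
    (q, p) ∈ A.profile x ↔ ∃ y : List Bool, y.length = x.length ∧ A.runMax q (x.zip y) = p := by
  unfold profile
  induction x using List.reverseRecOn generalizing p with
  | nil => simp [guess, runMax, eq_comm]
  | append_singleton x a ih =>
    rw [NFA.eval_append_singleton, NFA.mem_stepSet]
    constructor
    · rintro ⟨⟨q', p'⟩, hmem, b, hb⟩
      obtain ⟨hq, hp⟩ := Prod.ext_iff.1 hb
      dsimp only at hq hp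
      subst hq hp
      obtain ⟨y, hy, rfl⟩ := ih.1 hmem
      refine ⟨y ++ [b], by simp [hy], ?_⟩
      rw [List.zip_append hy.symm]
      exact A.runMax_append_singleton _ _ _
    · rintro ⟨y, hy, rfl⟩
      obtain rfl | ⟨y, b, rfl⟩ := List.eq_nil_or_concat' y
      · simp at hy
      · have hy' : y.length = x.length := by simpa using hy
        refine ⟨(q, A.runMax q (x.zip y)), ih.2 ⟨y, hy', rfl⟩, b, ?_⟩
        rw [List.zip_append hy'.symm]
        exact congrArg (Prod.mk q) (A.runMax_append_singleton _ _ _)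

theorem evalFrom_flatten_replicate {α σ : Type*} (M : DFA α σ) {s : σ} {v : List α}
    (h : M.evalFrom s v = s) (k : ℕ) : M.evalFrom s (List.replicate k v).flatten = s := by
  induction k with
  | zero => rfl
  | succ k ih => rw [List.replicate_succ, List.flatten_cons, DFA.evalFrom_of_append, h, ih]

theorem card_colour [Fintype Q] : Nat.card A.Colour = A.numColours := by
  classical
  rw [numColours, Nat.card_eq_card_toFinset, Set.toFinset_range]

/-- A word with at least as many letters as there are profiles can be pumped to a word with the
same profile and of any length. -/
theorem exists_profile_eq_of_le_length [Fintype Q] {x : List Bool}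
    (hx : 2 ^ (Fintype.card Q * (Fintype.card Q * A.numColours)) ≤ x.length) (k : ℕ) :
    ∃ x', A.profile x' = A.profile x ∧ k ≤ x'.length := by
  classical
  obtain ⟨q, u, v, z, rfl, -, hv, hu, hvv, hz⟩ :=
    A.guess.toDFA.evalFrom_split (s := A.guess.toDFA.start) (x := x)
      (by
        rw [Fintype.card_set, Fintype.card_prod, Fintype.card_prod, ← Nat.card_eq_fintype_card
          (α := A.Colour), card_colour]
        exact hx) rfl
  refine ⟨u ++ (List.replicate k v).flatten ++ z, ?_, ?_⟩
  · have h1 : A.guess.toDFA.eval (u ++ (List.replicate k v).flatten ++ z) =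
        A.guess.toDFA.eval (u ++ v ++ z) := by
      change A.guess.toDFA.evalFrom _ _ = A.guess.toDFA.eval _
      rw [DFA.evalFrom_of_append, DFA.evalFrom_of_append, hu, evalFrom_flatten_replicate _ hvv, hz]
      rfl
    exact h1
  · have : 0 < v.length := List.length_pos_iff.2 hv
    simp only [List.length_append, List.length_flatten, List.map_replicate, List.sum_replicate,
      smul_eq_mul]
    nlinarith

/-! ### Replacing blocks by pumped blocks -/

/-- The concatenation of the words that replace the first `i` blocks of length `N` of `a`. The
replacement `pump B k` of a block `B` is asked to be longer than `h l`, where `l` is the length of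
the concatenation so far; so the output of an `h`-delay operator on the blocks so far is determined
once the next block is known. -/
def pumped (pump : List Bool → ℕ → List Bool) (h : ℕ → ℕ) (N : ℕ) (a : Word Bool) : ℕ → List Bool
  | 0 => []
  | i + 1 => pumped pump h N a i ++ pump (seg a (i * N) N) (h (pumped pump h N a i).length + 1)

/-- The infinite word whose prefixes are the words `P i`; the default value is never used if
these words are prefixes of each other and their lengths are strictly increasing. -/
def limitWord (P : ℕ → List Bool) : Word Bool := fun j => (P (j + 1)).getD j false

theorem limitWord_eq_getD {P : ℕ → List Bool} (hpre : ∀ i, P i <+: P (i + 1))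
    (hlen : StrictMono fun i => (P i).length) {i j : ℕ} (hj : j < (P i).length) :
    limitWord P j = (P i).getD j false := by
  have hmono : ∀ i k, P i <+: P (i + k) := by
    intro i k
    induction k with
    | zero => exact List.prefix_rfl
    | succ k ih => exact ih.trans (hpre _)
  have hget : ∀ {i k : ℕ}, i ≤ k → j < (P i).length → (P k).getD j false = (P i).getD j false := by
    intro i k hik hj
    obtain ⟨k, rfl⟩ := Nat.exists_eq_add_of_le hik
    obtain ⟨t, ht⟩ := hmono i k
    rw [← ht, List.getD_append _ _ _ _ hj]
  have hj' : j < (P (j + 1)).length := hlen.le_apply (x := j + 1)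
  rcases le_total i (j + 1) with h | h
  · exact hget h hj
  · exact (hget h hj').symm

theorem seg_eq_of_forall {w : Word Bool} {i : ℕ} {x : List Bool}
    (h : ∀ j < x.length, w (i + j) = x.getD j false) : seg w i x.length = x := by
  refine List.ext_getElem (by simp) fun j h1 h2 => ?_
  simp [seg, h j h2, h2]

theorem pumped_congr (pump : List Bool → ℕ → List Bool) (h : ℕ → ℕ) (N : ℕ) {a a' : Word Bool}
    (i : ℕ) (ha : ∀ j < i * N, a j = a' j) : pumped pump h N a i = pumped pump h N a' i := by
  induction i with
  | zero => rfl
  | succ i ih =>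
    rw [add_mul, one_mul] at ha
    rw [pumped, pumped, ih fun j hj => ha j (by omega), seg_congr ha]

open Classical in
/-- A block of output for the input block `B` that leads from `q` to `p`, if there is one. -/
noncomputable def answer (B : List Bool) (q : Q) (p : Q × A.Colour) : List Bool :=
  if h : (q, p) ∈ A.profile B then (A.mem_profile.1 h).choose else []

theorem answer_spec {B : List Bool} {q : Q} {p : Q × A.Colour} (h : (q, p) ∈ A.profile B) :
    (A.answer B q p).length = B.length ∧ A.runMax q (B.zip (A.answer B q p)) = p := by
  rw [answer, dif_pos h]
  exact (A.mem_profile.1 h).choose_spec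

/-- Block lengths that allow pumping turn an operator of arbitrary finite delay into one of
constant delay: an output block is chosen when its input block and the next one are known. -/
theorem exists_constantDelay [Finite Q] {h : ℕ → ℕ} (hh : Monotone h) {F : Word Bool → Word Bool}
    (hF : IsDelayOperator h F) (hs : Solves A.language F) {N : ℕ} (hN : 0 < N)
    (hpump : ∀ x : List Bool, x.length = N →
      ∀ k, ∃ x', A.profile x' = A.profile x ∧ k ≤ x'.length) :
    ∃ G, IsConstantDelayOperator (2 * N - 1) G ∧ Solves A.language G := by
  -- Choice needs a total function; words of other lengths than `N` are sent to `[]`.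
  have hpump' : ∀ x : List Bool, ∀ k, ∃ x', x.length = N →
      A.profile x' = A.profile x ∧ k ≤ x'.length := fun x k => by
    by_cases hx : x.length = N
    · exact (hpump x hx k).imp fun x' h _ => h
    · exact ⟨[], fun h => absurd h hx⟩
  choose pump hpump using hpump'
  set P : Word Bool → ℕ → List Bool := pumped pump h N with hP
  set B : Word Bool → ℕ → List Bool := fun a i => seg a (i * N) N with hB
  set X : Word Bool → ℕ → List Bool := fun a i => pump (B a i) (h (P a i).length + 1) with hX
  have hPsucc : ∀ a i, P a (i + 1) = P a i ++ X a i := fun a i => rfl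
  have hBlen : ∀ a i, (B a i).length = N := fun a i => length_seg _ _ _
  have hXprof : ∀ a i, A.profile (X a i) = A.profile (B a i) :=
    fun a i => (hpump _ _ (hBlen a i)).1
  have hXlen : ∀ a i, h (P a i).length < (X a i).length :=
    fun a i => (hpump _ _ (hBlen a i)).2
  have hlenadd : ∀ a i, (P a (i + 1)).length = (P a i).length + (X a i).length :=
    fun a i => by rw [hPsucc, List.length_append]
  have hlen : ∀ a, StrictMono fun i => (P a i).length := fun a =>
    strictMono_nat_of_lt_succ fun i => by
      have := hXlen a i
      have := hlenadd a i
      omega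
  have hpre : ∀ a i, P a i <+: P a (i + 1) := fun a i => ⟨X a i, (hPsucc a i).symm⟩
  -- `a` with all its blocks replaced, and the answer of `F` to it
  set α : Word Bool → Word Bool := fun a => limitWord (P a) with hα
  set W : Word Bool → Word (Bool × Bool) := fun a => pairWord (α a) (F (α a)) with hW
  have hαseg : ∀ a i, seg (α a) (P a i).length (X a i).length = X a i := fun a i =>
    seg_eq_of_forall fun j hj => by
      rw [hα]
      simp only
      rw [limitWord_eq_getD (hpre a) (hlen a) (i := i + 1) (by rw [hlenadd]; omega), hPsucc,
        List.getD_append_right _ _ _ _ (by omega), Nat.add_sub_cancel_left]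
  -- the states at the ends of the replaced blocks, and the transitions over these blocks
  set q : Word Bool → ℕ → Q := fun a i => A.run (W a) (P a i).length with hq
  set r : Word Bool → ℕ → Q × A.Colour := fun a i =>
    A.runMax (q a i) (seg (W a) (P a i).length (X a i).length) with hr
  have hr1 : ∀ a i, (r a i).1 = q a (i + 1) := fun a i => by
    rw [hr]
    simp only [hq]
    rw [runMax_seg_fst, hlenadd]
  have hmem : ∀ a i, (q a i, r a i) ∈ A.profile (B a i) := fun a i => by
    rw [← hXprof, mem_profile]
    refine ⟨seg (F (α a)) (P a i).length (X a i).length, length_seg _ _ _, ?_⟩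
    have := seg_pairWord (α a) (F (α a)) (P a i).length (X a i).length
    rw [hαseg] at this
    rw [← this]
  -- the output blocks for the original input blocks
  set z : Word Bool → ℕ → List Bool := fun a i => A.answer (B a i) (q a i) (r a i) with hz
  have hzlen : ∀ a i, (z a i).length = N := fun a i =>
    ((A.answer_spec (hmem a i)).1).trans (hBlen a i)
  have hzrun : ∀ a i, A.runMax (q a i) ((B a i).zip (z a i)) = r a i := fun a i =>
    (A.answer_spec (hmem a i)).2
  refine ⟨fun a j => (z a (j / N)).getD (j % N) false, ?_, ?_⟩
  · intro j a a' haa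
    set i := j / N with hi
    have hij : i * N ≤ j := Nat.div_mul_le_self j N
    have hagree : ∀ k < (i + 2) * N, a k = a' k := fun k hk => haa k (by
      rw [add_mul] at hk
      simp only
      omega)
    have hPeq : ∀ l ≤ i + 2, P a l = P a' l := fun l hl =>
      pumped_congr pump h N l fun k hk => hagree k (hk.trans_le (Nat.mul_le_mul_right N hl))
    have hBeq : B a i = B a' i := seg_congr fun k hk => hagree k (by
      rw [add_mul]
      omega)
    have hXeq : X a i = X a' i := by simp only [hX, hBeq, hPeq i (by omega)]
    have hαeq : ∀ k < (P a (i + 2)).length, α a k = α a' k := fun k hk => by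
      simp only [hα]
      rw [limitWord_eq_getD (hpre a) (hlen a) hk, hPeq _ le_rfl,
        limitWord_eq_getD (hpre a') (hlen a') (by rwa [← hPeq _ le_rfl])]
    -- The replaced block `i + 1` is longer than the delay of `F` requires, so `F` has answered all
    -- replaced blocks up to `i`.
    have hWeq : ∀ k < (P a (i + 1)).length, W a k = W a' k := fun k hk => by
      refine Prod.ext (hαeq k (hk.trans (hlen a (Nat.lt_succ_self _)))) ?_
      refine hF k _ _ fun l hl => hαeq l ?_
      change l < (P a (i + 1 + 1)).length
      have h1 := hh hk.le
      have h2 := hXlen a (i + 1)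
      have h3 := hlenadd a (i + 1)
      omega
    have hrun : ∀ k ≤ (P a (i + 1)).length, A.run (W a) k = A.run (W a') k := by
      intro k hk
      induction k with
      | zero => rfl
      | succ k ih => rw [run, run, ih (by omega), hWeq k (by omega)]
    have hqeq : q a i = q a' i := by
      simp only [hq]
      rw [← hPeq i (by omega)]
      exact hrun _ ((hlen a).monotone (Nat.le_succ i))
    have hreq : r a i = r a' i := by
      simp only [hr]
      rw [hqeq, ← hXeq, ← hPeq i (by omega), seg_congr (w' := W a') fun k hk => hWeq k (by
        rw [hlenadd]
        exact hk)]
    simp only [hz, ← hi, hBeq, hqeq, hreq]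
  · intro a
    set G : Word Bool := fun j => (z a (j / N)).getD (j % N) false with hG
    have hGseg : ∀ i, seg G (i * N) N = z a i := fun i => by
      have := seg_eq_of_forall (w := G) (i := i * N) (x := z a i) fun j hj => by
        rw [hzlen] at hj
        simp only [hG]
        rw [mul_comm, Nat.mul_add_div hN, Nat.div_eq_of_lt hj, Nat.mul_add_mod,
          Nat.mod_eq_of_lt hj, add_zero]
      rwa [hzlen] at this
    have hseg : ∀ i, seg (pairWord a G) (i * N) N = (B a i).zip (z a i) := fun i => by
      rw [seg_pairWord, hGseg]
    have hrun : ∀ i, A.run (pairWord a G) (i * N) = q a i := by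
      intro i
      induction i with
      | zero => rw [zero_mul]; rfl
      | succ i ih => rw [add_mul, one_mul, ← runMax_seg_fst, ih, hseg, hzrun, hr1]
    refine A.mem_language_of_blocks (hlen a) rfl (p' := fun i => i * N)
      (fun i j hij => Nat.mul_lt_mul_of_pos_right hij hN) (zero_mul N) (fun i => ?_) (hs (α a))
    have h1 : (P a (i + 1)).length - (P a i).length = (X a i).length := by
      rw [hlenadd, Nat.add_sub_cancel_left]
    have h2 : (i + 1) * N - i * N = N := by rw [add_mul, one_mul, Nat.add_sub_cancel_left]
    simp only
    rw [h1, h2, hrun, hseg, hzrun]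

end DPA

theorem card_profiles_le_delayBound {n : ℕ} (hn : 0 < n) (m : ℕ) :
    2 ^ (n * (n * m)) ≤ delayBound n m := by
  refine Nat.pow_le_pow_right (by norm_num) ?_
  rcases Nat.eq_zero_or_pos m with rfl | hm
  · simp
  · calc n * (n * m) ≤ (m * n) ^ 2 := by nlinarith [Nat.mul_le_mul_left (n * n * m) hm]
      _ ≤ (m * n) ^ (2 * n) := Nat.pow_le_pow_right (Nat.mul_pos hm hn) (by omega)

end DelayGame

theorem theorem6p4 {Q : Type*} [Fintype Q] (A : DelayGame.DPA (Bool × Bool) Q) (n m : ℕ)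
    (hn : Fintype.card Q = n) (hm : A.numColours = m) :
    (DelayGame.SolvableWithFiniteDelay A.language ↔
      DelayGame.SolvableWithConstantDelay A.language (2 * DelayGame.delayBound n m - 1)) ∧
    ((∃ F : DelayGame.Word Bool → DelayGame.Word Bool,
        Continuous F ∧ DelayGame.Solves A.language F) ↔
      (∃ F : DelayGame.Word Bool → DelayGame.Word Bool,
        DelayGame.IsConstantDelayOperator (2 * DelayGame.delayBound n m - 1) F ∧
          DelayGame.Solves A.language F)) ∧
    (DelayGame.SolvableWithFiniteDelay A.language ↔
      ∃ F : DelayGame.Word Bool → DelayGame.Word Bool,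
        Continuous F ∧ DelayGame.Solves A.language F) := by
  subst hn hm
  have hcore : (∃ F : DelayGame.Word Bool → DelayGame.Word Bool,
      Continuous F ∧ DelayGame.Solves A.language F) →
      ∃ F : DelayGame.Word Bool → DelayGame.Word Bool,
        DelayGame.IsConstantDelayOperator
          (2 * DelayGame.delayBound (Fintype.card Q) A.numColours - 1) F ∧
            DelayGame.Solves A.language F := by
    rintro ⟨F, hc, hs⟩
    obtain ⟨h, hh, hF⟩ := DelayGame.exists_isDelayOperator_of_continuous hc
    refine A.exists_constantDelay hh hF hs (Nat.two_pow_pos _) fun x hx k =>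
      A.exists_profile_eq_of_le_length ?_ k
    rw [hx]
    exact DelayGame.card_profiles_le_delayBound (Fintype.card_pos_iff.2 ⟨A.start⟩) _
  have hcont : ∀ {h : ℕ → ℕ}, (∃ F, DelayGame.IsDelayOperator h F ∧
      DelayGame.Solves A.language F) → ∃ F : DelayGame.Word Bool → DelayGame.Word Bool,
        Continuous F ∧ DelayGame.Solves A.language F :=
    fun ⟨F, hF, hs⟩ => ⟨F, hF.continuous, hs⟩
  rw [DelayGame.solvableWithConstantDelay_iff, DelayGame.solvableWithFiniteDelay_iff]
  refine ⟨⟨fun ⟨_, hF⟩ => hcore (hcont hF), fun hF => ⟨_, hF⟩⟩, ⟨hcore, hcont⟩,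
    ⟨fun ⟨_, hF⟩ => hcont hF, fun hF => ⟨_, hcore hF⟩⟩⟩
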